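/- Let $X\subset\mathbb R^n$, $n\ge 16$, be compact and convex, put $$s_X=\max\{s\ge 0:\ sB^n_\infty\subseteq X\},\qquad B^n_\infty=\{x\in\mathbb R^n:\ |x_i|\le 1\ \text{for all } i\},$$ and let $\mathcal F_{\rm Lip}$ be the set of all convex functions $f:X\to\mathbb R$ that are $1$-Lipschitz in the Euclidean norm $\|\cdot\|$. Let $(f,x)\mapsto g(f,x)\in\mathbb R^n$ ($f\in\mathcal F_{\rm Lip}$, $x\in X$) be any deterministic selector, measurable in $x$, of subgradients, where subgradients at boundary points are taken with respect to a Lipschitz continuation of $f$: for each $f$ there is a convex extension $F:\mathbb R^n\to\mathbb R$ of $f$ with the same Lipschitz constant, such that $F(y)\ge F(x)+\langle g(f,x),y-x\rangle$ for all $x\in X$, $y\in\mathbb R^n$ (equivalently, $f(y)\ge f(x)+\langle g(f,x),y-x\rangle$ for all $x,y\in X$ and $\|g(f,x)\|$ is at most the Lipschitz constant of $f$; this bound is automatic at interior points). Let $\sigma\ge 0$. Queried at $x\in X$ about $f$, the first-order Gaussian (FOG) oracle returns $(f(x)+W,\ g(f,x)+Z)$ and the subgradient-only Gaussian (SOG)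 oracle returns $g(f,x)+Z$, where $W\sim\mathcal N(0,\sigma^2)$ and $Z\sim\mathcal N(0,\sigma^2 I_n)$ are independent of each other and of all earlier noise. A $T$-step algorithm is a deterministic measurable rule that chooses each query $X_t\in X$, $t=1,\dots,T$, and the final output $X_{T+1}\in X$ as a function of all previous queries and oracle responses. For $r\ge 1$, $\varepsilon>0$ and $\delta\in(0,1)$, the complexity $K^{(r)}(\varepsilon,\delta)$ is the least $T\ge 1$ for which there is a $T$-step algorithm with $$\sup_{f\in\mathcal F_{\rm Lip}}\Pr\Big(\big(f(X_{T+1})-\inf_X f\big)^r\ge\varepsilon\Big)\le\delta$$ (and $+\infty$ if there is none). Theorem. For all $r\ge 1$, $0<\varepsilon\le\big(s_X\sqrt{n/8}\big)^r$ and $\delta\in(0,1/2)$, $$K^{(r)}(\varepsilon,\delta)\ \ge\ \frac{((1-\delta)n-8)\,n\,s_X^2\log 2}{128\,(n s_X^2+1)}\cdot\frac{\sigma^2}{\varepsilon^{2/r}}\quad\text{for the FOG oracle,}$$ $$K^{(r)}(\varepsilon,\delta)\ \ge\ \frac{((1-\delta)n-8)\,n\,s_X^2\log 2}{128}\cdot\frac{\sigma^2}{\varepsilon^{2/r}}\quad\text{for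 the SOG oracle.}$$ -/

import Mathlib

open MeasureTheory ProbabilityTheory
open scoped NNReal ENNReal

/-- `ℝⁿ` with the Euclidean (`ℓ²`) norm. -/
abbrev Rn (n : ℕ) : Type := EuclideanSpace ℝ (Fin n)

/-! ### Problem classes, algorithms, complexity -/

/-- Convexity of a real function that is only defined on a subset `X` of `ℝⁿ`. -/
def IsConvexFun {n : ℕ} {X : Set (Rn n)} (f : X → ℝ) : Prop :=
  ∀ (x y z : X) (a b : ℝ), 0 ≤ a → 0 ≤ b → a + b = 1 →
    (z : Rn n) = a • (x : Rn n) + b • (y : Rn n) → f z ≤ a * f x + b * f y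

/-- A problem class `(X, ℱ, 𝒪)`: a compact convex domain `X ⊆ ℝⁿ`, a class `ℱ` of convex functions
on `X`, and an oracle, i.e. an information space `Info` and, for each instance `f`, a Markov
kernel `P(dy | f, x)` from queries `x ∈ X` to responses.  (No regularity in `f` is imposed.) -/
structure ProblemClass (n : ℕ) where
  domain : Set (Rn n)
  isCompact_domain : IsCompact domain
  convex_domain : Convex ℝ domain
  instances : Set (domain → ℝ)
  isConvexFun_of_mem : ∀ f ∈ instances, IsConvexFun f
  Info : Type
  [measurableSpaceInfo : MeasurableSpace Info]
  [standardBorelInfo : StandardBorelSpace Info]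
  oracle : instances → Kernel domain Info
  isMarkovKernel_oracle : ∀ f, IsMarkovKernel (oracle f)

attribute [instance] ProblemClass.measurableSpaceInfo ProblemClass.standardBorelInfo
  ProblemClass.isMarkovKernel_oracle

/-- A (deterministic) `T`-step algorithm: `next t` produces the query number `t + 1` from the first
`t` query-response pairs, for `t = 0, …, T - 1`, and `next T` produces the final output. -/
structure Algorithm {n : ℕ} (P : ProblemClass n) (T : ℕ) where
  next : (t : Fin (T + 1)) → (Fin t → P.domain × P.Info) → P.domain
  measurable_next : ∀ t, Measurable (next t)

namespace Algorithm

variable {n : ℕ} {P : ProblemClass n} {T : ℕ}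

/-- The joint law of the first `t` query-response pairs when the algorithm interacts with the
oracle on the instance `f`: given the history `h`, the next query is `x = next t h`, and the
response is drawn from `P(dy | f, x)`. -/
noncomputable def historyLaw (A : Algorithm P T) (f : P.instances) :
    (t : ℕ) → t ≤ T → Measure (Fin t → P.domain × P.Info)
  | 0, _ => Measure.dirac Fin.elim0
  | t + 1, ht =>
      let q : (Fin t → P.domain × P.Info) → P.domain := A.next ⟨t, by omega⟩
      ((A.historyLaw f t (by omega)) ⊗ₘ
          ((P.oracle f).comap q (A.measurable_next ⟨t, by omega⟩))).map
        (fun p => Fin.snoc (α := fun _ => P.domain × P.Info) p.1 (q p.1, p.2))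

/-- The error `f(X_{T+1}) - inf_X f` as a function of the history of the `T` oracle calls. -/
noncomputable def err (A : Algorithm P T) (f : P.instances)
    (h : Fin T → P.domain × P.Info) : ℝ :=
  f.1 (A.next (Fin.last T) h) - ⨅ x : P.domain, f.1 x

/-- `Pr (err^r ≥ ε)` for the instance `f`. -/
noncomputable def failureProb (A : Algorithm P T) (f : P.instances) (r ε : ℝ) : ℝ≥0∞ :=
  A.historyLaw f T le_rfl {h | ε ≤ A.err f h ^ r}

end Algorithm

/-- The `r`-th order `(ε, δ)`-complexity: the least `T ≥ 1` for which some `T`-step algorithm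
satisfies `sup_f Pr (err^r ≥ ε) ≤ δ` (and `⊤` if there is none). -/
noncomputable def complexity {n : ℕ} (P : ProblemClass n) (r ε δ : ℝ) : ℕ∞ :=
  sInf {K : ℕ∞ | ∃ T : ℕ, 1 ≤ T ∧ K = T ∧
    ∃ A : Algorithm P T, ⨆ f : P.instances, A.failureProb f r ε ≤ ENNReal.ofReal δ}

/-! ### Convex Lipschitz functions and Gaussian oracles -/

/-- The class of all convex `1`-Lipschitz functions `X → ℝ`. -/
def lipClass {n : ℕ} (X : Set (Rn n)) : Set (X → ℝ) :=
  {f | IsConvexFun f ∧ LipschitzWith 1 f}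

/-- `g` is a subgradient of `F : ℝⁿ → ℝ` at `x`. -/
def IsSubgradient {n : ℕ} (F : Rn n → ℝ) (x g : Rn n) : Prop :=
  ∀ y : Rn n, F x + inner ℝ g (y - x) ≤ F y

/-- `F : ℝⁿ → ℝ` is a convex extension of `f : X → ℝ` to the whole space that keeps the Lipschitz
constant of `f`. -/
structure IsLipConvexExtension {n : ℕ} {X : Set (Rn n)} (f : X → ℝ) (F : Rn n → ℝ) : Prop where
  convexOn : ConvexOn ℝ Set.univ F
  eq_on : ∀ x : X, F x = f x
  lipschitz : ∀ L : ℝ≥0, LipschitzWith L f → LipschitzWith L F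

/-- A deterministic subgradient selector `(f, x) ↦ g(x) ∈ ∂f(x)` on the convex `1`-Lipschitz
functions.  The subgradient inequality is required on all of `ℝⁿ`, where `f` is continued with the
same Lipschitz constant.  Equivalently: `f y ≥ f x + ⟪g(x), y - x⟫` for `y ∈ X`, and `‖g(x)‖` is at
most the Lipschitz constant of `f` on `X`; at interior points of `X` the bound is automatic, and at
boundary points it excludes arbitrarily long normal vectors of `X`. -/
structure SubgradientSelector {n : ℕ} (X : Set (Rn n)) where
  grad : lipClass X → X → Rn n
  measurable_grad : ∀ f, Measurable (grad f)
  isSubgradient : ∀ f : lipClass X, ∃ F : Rn n → ℝ,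
    IsLipConvexExtension f.1 F ∧ ∀ x : X, IsSubgradient F x (grad f x)

/-- The law `𝒩(0, σ² Iₙ)` on `ℝⁿ`. -/
noncomputable def gaussianVec (n : ℕ) (σ : ℝ≥0) : Measure (Rn n) :=
  (stdGaussian (Rn n)).map (fun z => (σ : ℝ) • z)

instance (n : ℕ) (σ : ℝ≥0) : IsProbabilityMeasure (gaussianVec n σ) :=
  Measure.isProbabilityMeasure_map (by fun_prop)

/-- The kernel `x ↦ law of ψ(x) + N`, where `N` has law `ν`. -/
noncomputable def additiveNoise {α β : Type*} [MeasurableSpace α] [MeasurableSpace β] [Add β]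
    (ψ : α → β) (hψ : Measurable ψ) (ν : Measure β) : Kernel α β :=
  (Kernel.deterministic ψ hψ ×ₖ Kernel.const α ν).map (fun p => p.1 + p.2)

theorem isMarkovKernel_additiveNoise {α β : Type*} [MeasurableSpace α] [MeasurableSpace β] [Add β]
    [MeasurableAdd₂ β] (ψ : α → β) (hψ : Measurable ψ) (ν : Measure β) [IsProbabilityMeasure ν] :
    IsMarkovKernel (additiveNoise ψ hψ ν) :=
  Kernel.IsMarkovKernel.map _ (measurable_fst.add measurable_snd)

/-- Convex `1`-Lipschitz functions on `X` with the first-order Gaussian (FOG) oracle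
`Y = (f(x) + W, g(x) + Z)`, with `W ∼ 𝒩(0, σ²)` and `Z ∼ 𝒩(0, σ² Iₙ)` independent. -/
noncomputable def lipFOG {n : ℕ} (X : Set (Rn n)) (hX : IsCompact X) (hX' : Convex ℝ X)
    (g : SubgradientSelector X) (σ : ℝ≥0) : ProblemClass n where
  domain := X
  isCompact_domain := hX
  convex_domain := hX'
  instances := lipClass X
  isConvexFun_of_mem := fun _ hf => hf.1
  Info := ℝ × Rn n
  oracle f := additiveNoise (fun x => (f.1 x, g.grad f x))
    (f.2.2.continuous.measurable.prodMk (g.measurable_grad f))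
    ((gaussianReal 0 (σ ^ 2)).prod (gaussianVec n σ))
  isMarkovKernel_oracle _ := isMarkovKernel_additiveNoise _ _ _

/-- Convex `1`-Lipschitz functions on `X` with the subgradient-only Gaussian (SOG) oracle
`Y = g(x) + Z`, with `Z ∼ 𝒩(0, σ² Iₙ)`. -/
noncomputable def lipSOG {n : ℕ} (X : Set (Rn n)) (hX : IsCompact X) (hX' : Convex ℝ X)
    (g : SubgradientSelector X) (σ : ℝ≥0) : ProblemClass n where
  domain := X
  isCompact_domain := hX
  convex_domain := hX'
  instances := lipClass X
  isConvexFun_of_mem := fun _ hf => hf.1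
  Info := Rn n
  oracle f := additiveNoise (g.grad f) (g.measurable_grad f) (gaussianVec n σ)
  isMarkovKernel_oracle _ := isMarkovKernel_additiveNoise _ _ _

/-- `s_X`, the largest `s ≥ 0` such that the cube `s B_∞ⁿ = {x | ∀ i, |x i| ≤ s}` lies in `X`. -/
noncomputable def cubeRadius {n : ℕ} (X : Set (Rn n)) : ℝ :=
  sSup {s : ℝ | 0 ≤ s ∧ {x : Rn n | ∀ i, |x i| ≤ s} ⊆ X}

/-- For a compact `X` that contains the origin (and `n ≥ 1`), the maximum that defines `s_X`
is attained.  (If `0 ∉ X`, the set is empty and `cubeRadius X = 0`.) -/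
theorem isGreatest_cubeRadius {n : ℕ} (hn : 0 < n) {X : Set (Rn n)} (hX : IsCompact X)
    (h0 : (0 : Rn n) ∈ X) :
    IsGreatest {s : ℝ | 0 ≤ s ∧ {x : Rn n | ∀ i, |x i| ≤ s} ⊆ X} (cubeRadius X) := by
  set S := {s : ℝ | 0 ≤ s ∧ {x : Rn n | ∀ i, |x i| ≤ s} ⊆ X} with hS
  have hne : (0 : ℝ) ∈ S := by
    refine ⟨le_rfl, fun x hx => ?_⟩
    have : x = 0 := by
      ext i
      simpa using hx i
    rwa [this]
  have hbdd : BddAbove S := by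
    obtain ⟨R, hR⟩ := hX.isBounded.exists_norm_le
    refine ⟨R, fun s hs => ?_⟩
    have hmem : (WithLp.toLp 2 (fun _ : Fin n => s) : Rn n) ∈ X :=
      hs.2 (fun i => (abs_of_nonneg hs.1).le)
    refine le_trans ?_ ((PiLp.norm_apply_le _ (⟨0, hn⟩ : Fin n)).trans (hR _ hmem))
    exact le_abs_self s
  refine ⟨⟨le_csSup hbdd hne, fun x hx => ?_⟩, fun s hs => le_csSup hbdd hs⟩
  have key : ∀ t ∈ Set.Ico (0 : ℝ) 1, t • x ∈ X := by
    intro t ht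
    rcases (le_csSup hbdd hne).eq_or_lt with h | h
    · have hx0 : x = 0 := by
        ext i
        have := hx i
        rw [cubeRadius, ← hS, ← h] at this
        simpa using this
      simpa [hx0] using h0
    · obtain ⟨s, hs, hlt⟩ := exists_lt_of_lt_csSup ⟨0, hne⟩
        (show t * sSup S < sSup S by nlinarith [ht.2])
      refine hs.2 (fun i => ?_)
      have hi : |x i| ≤ sSup S := hx i
      calc |(t • x) i| = t * |x i| := by simp [abs_mul, abs_of_nonneg ht.1]
        _ ≤ t * sSup S := mul_le_mul_of_nonneg_left hi ht.1
        _ ≤ s := hlt.le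
  have hlim : Filter.Tendsto (fun t : ℝ => t • x) (nhdsWithin 1 (Set.Iio 1)) (nhds x) := by
    have : Filter.Tendsto (fun t : ℝ => t • x) (nhds 1) (nhds ((1 : ℝ) • x)) :=
      (continuous_id.smul continuous_const).tendsto 1
    rw [one_smul] at this
    exact this.mono_left nhdsWithin_le_nhds
  refine hX.isClosed.mem_of_tendsto hlim ?_
  filter_upwards [Ico_mem_nhdsLT (show (0 : ℝ) < 1 by norm_num)] with t ht using key t ht

/-! The bound is Fano's inequality applied to a packing of cones. Put η = ε^(1/r) and s = s_X. A
binary code with at least 2^(n/8) words at mutual Hamming distance at least n/8 selects vertices of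
the cube s·[-1,1]ⁿ ⊆ X. The instances are the cones L‖x - c‖ with these vertices as apexes, where L²
= 8η²/(ns²). The slope L is just large enough that no point is η-optimal for two cones, and the
upper bound on ε is exactly what gives L ≤ 1 (`exists_coneFamily`).

One response reveals little. Any two cones have subgradients at distance at most 2L, whatever the
selector, and values at distance at most L·2s√n, so the Gaussian responses have relative entropy at
most 2L²/σ² (SOG) or 2L²(ns² + 1)/σ² (FOG). By the chain rule, T adaptive responses carry at most T
times as much (`entropyBound_historyLaw`). Identifying one of |V| instances with probability 1 - δ
requires entropy of at least (1 - δ) log |V| - log 2 (`Algorithm.log_card_le`); solving for T gives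
both bounds.

Relative entropy enters only as an upper bound, tested on bounded functions. This form needs no
densities or absolute continuity, and it passes directly to images. -/

/-! ### Relative entropy in variational form -/

/-- `P` has relative entropy at most `D` with respect to `Q`, in the variational form of Donsker
and Varadhan. -/
def EntropyBound {α : Type*} [MeasurableSpace α] (P Q : Measure α) (D : ℝ) : Prop :=
  ∀ φ : α → ℝ, Measurable φ → (∃ C, ∀ x, |φ x| ≤ C) →
    ∫ x, φ x ∂P ≤ D + Real.log (∫ x, Real.exp (φ x) ∂Q)

theorem integrable_of_abs_le {α : Type*} [MeasurableSpace α] {μ : Measure α} [IsFiniteMeasure μ]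
    {φ : α → ℝ} (hφ : Measurable φ) {C : ℝ} (hC : ∀ x, |φ x| ≤ C) : Integrable φ μ :=
  Integrable.of_bound hφ.aestronglyMeasurable C (ae_of_all _ hC)

theorem integrable_exp_of_abs_le {α : Type*} [MeasurableSpace α] {μ : Measure α}
    [IsFiniteMeasure μ] {φ : α → ℝ} (hφ : Measurable φ) {C : ℝ} (hC : ∀ x, |φ x| ≤ C) :
    Integrable (fun x => Real.exp (φ x)) μ :=
  integrable_of_abs_le hφ.exp (C := Real.exp C) fun x => by
    rw [abs_of_pos (Real.exp_pos _)]
    exact Real.exp_le_exp.2 (abs_le.1 (hC x)).2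

/-- Keeps exponential moments positive, so that `Real.log` is never taken at its default value. -/
theorem exp_neg_le_integral_exp {α : Type*} [MeasurableSpace α] {μ : Measure α}
    [IsProbabilityMeasure μ] {φ : α → ℝ} (hφ : Measurable φ) {C : ℝ} (hC : ∀ x, |φ x| ≤ C) :
    Real.exp (-C) ≤ ∫ x, Real.exp (φ x) ∂μ := by
  have := integral_mono (integrable_const (Real.exp (-C))) (integrable_exp_of_abs_le (μ := μ) hφ hC)
    fun x => Real.exp_le_exp.2 (abs_le.1 (hC x)).1
  simpa using this

theorem integral_exp_le_exp {α : Type*} [MeasurableSpace α] {μ : Measure α}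
    [IsProbabilityMeasure μ] {φ : α → ℝ} (hφ : Measurable φ) {C : ℝ} (hC : ∀ x, |φ x| ≤ C) :
    ∫ x, Real.exp (φ x) ∂μ ≤ Real.exp C := by
  have := integral_mono (integrable_exp_of_abs_le (μ := μ) hφ hC) (integrable_const (Real.exp C))
    fun x => Real.exp_le_exp.2 (abs_le.1 (hC x)).2
  simpa using this

namespace EntropyBound

variable {α β : Type*} [MeasurableSpace α] [MeasurableSpace β]

theorem mono {P Q : Measure α} {D D' : ℝ} (h : EntropyBound P Q D) (hD : D ≤ D') :
    EntropyBound P Q D' := fun φ hφ hC => (h φ hφ hC).trans (by gcongr)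

theorem map {P Q : Measure α} {D : ℝ} (h : EntropyBound P Q D) {f : α → β} (hf : Measurable f) :
    EntropyBound (P.map f) (Q.map f) D := by
  rintro φ hφ ⟨C, hC⟩
  rw [integral_map hf.aemeasurable hφ.aestronglyMeasurable,
    integral_map hf.aemeasurable hφ.exp.aestronglyMeasurable]
  exact h _ (hφ.comp hf) ⟨C, fun x => hC _⟩

/-- Jensen's inequality. -/
theorem refl (P : Measure α) [IsProbabilityMeasure P] : EntropyBound P P 0 := by
  rintro φ hφ ⟨C, hC⟩
  rw [zero_add, Real.le_log_iff_exp_le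
    ((Real.exp_pos _).trans_le (exp_neg_le_integral_exp (μ := P) hφ hC))]
  exact convexOn_exp.map_integral_le Real.continuous_exp.continuousOn isClosed_univ (by simp)
    (integrable_of_abs_le hφ hC) (integrable_exp_of_abs_le hφ hC)

/-- The chain rule for relative entropy. -/
theorem compProd {μ ν : Measure α} [IsProbabilityMeasure μ] [IsProbabilityMeasure ν]
    {κ η : Kernel α β} [IsMarkovKernel κ] [IsMarkovKernel η] {D₁ D₂ : ℝ}
    (h₁ : EntropyBound μ ν D₁) (h₂ : ∀ x, EntropyBound (κ x) (η x) D₂) :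
    EntropyBound (μ ⊗ₘ κ) (ν ⊗ₘ η) (D₁ + D₂) := by
  rintro φ hφ ⟨C, hC⟩
  have hsec : ∀ x, Measurable fun y => φ (x, y) := fun x => hφ.comp measurable_prodMk_left
  -- The conditional log-moment generating function of `φ` is bounded and measurable, hence itself a
  -- valid test function for `h₁`.
  set u : α → ℝ := fun x => Real.log (∫ y, Real.exp (φ (x, y)) ∂η x) with hu
  have hpos : ∀ x, 0 < ∫ y, Real.exp (φ (x, y)) ∂η x := fun x =>
    (Real.exp_pos _).trans_le (exp_neg_le_integral_exp (hsec x) fun y => hC (x, y))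
  have hum : Measurable u :=
    (hφ.exp.stronglyMeasurable.integral_kernel_prod_right' (κ := η)).measurable.log
  have huC : ∀ x, |u x| ≤ C := fun x => abs_le.2
    ⟨(Real.le_log_iff_exp_le (hpos x)).2
      (exp_neg_le_integral_exp (hsec x) fun y => hC (x, y)),
     (Real.log_le_iff_le_exp (hpos x)).2 (integral_exp_le_exp (hsec x) fun y => hC (x, y))⟩
  have hint : Integrable φ (μ ⊗ₘ κ) := integrable_of_abs_le hφ hC
  rw [Measure.integral_compProd hint,
    Measure.integral_compProd (integrable_exp_of_abs_le hφ hC)]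
  calc ∫ x, ∫ y, φ (x, y) ∂κ x ∂μ ≤ ∫ x, (D₂ + u x) ∂μ :=
        integral_mono (integrable_of_abs_le (C := C)
            (hφ.stronglyMeasurable.integral_kernel_prod_right' (κ := κ)).measurable fun x => by
              simpa using norm_integral_le_of_norm_le_const (μ := κ x) (f := fun y => φ (x, y))
                (ae_of_all _ fun y => hC (x, y)))
          ((integrable_const _).add (integrable_of_abs_le hum huC))
          fun x => h₂ x _ (hsec x) ⟨C, fun y => hC (x, y)⟩
    _ = D₂ + ∫ x, u x ∂μ := by
        rw [integral_add (integrable_const _) (integrable_of_abs_le hum huC)]; simp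
    _ ≤ D₂ + (D₁ + Real.log (∫ x, Real.exp (u x) ∂ν)) := by
        gcongr; exact h₁ u hum ⟨C, huC⟩
    _ = D₁ + D₂ + Real.log (∫ x, ∫ y, Real.exp (φ (x, y)) ∂η x ∂ν) := by
        simp only [hu, Real.exp_log (hpos _)]; ring

theorem prod {μ ν : Measure α} [IsProbabilityMeasure μ] [IsProbabilityMeasure ν]
    {μ' ν' : Measure β} [IsProbabilityMeasure μ'] [IsProbabilityMeasure ν'] {D₁ D₂ : ℝ}
    (h₁ : EntropyBound μ ν D₁) (h₂ : EntropyBound μ' ν' D₂) :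
    EntropyBound (μ.prod μ') (ν.prod ν') (D₁ + D₂) := by
  simpa using compProd (κ := Kernel.const α μ') (η := Kernel.const α ν') h₁ fun _ => by simpa

theorem pi {n : ℕ} {μ ν : Fin n → Measure α} [∀ i, IsProbabilityMeasure (μ i)]
    [∀ i, IsProbabilityMeasure (ν i)] {D : Fin n → ℝ} (h : ∀ i, EntropyBound (μ i) (ν i) (D i)) :
    EntropyBound (Measure.pi μ) (Measure.pi ν) (∑ i, D i) := by
  induction n with
  | zero =>
    rw [Measure.pi_of_empty μ default, Measure.pi_of_empty ν default, Fin.sum_univ_zero]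
    exact refl _
  | succ n ih =>
    rw [Fin.sum_univ_succ, ← ((measurePreserving_piFinSuccAbove μ 0).symm).map_eq,
      ← ((measurePreserving_piFinSuccAbove ν 0).symm).map_eq]
    exact ((h 0).prod (ih fun i => h i.succ)).map (MeasurableEquiv.measurable _)

/-- The density of the second law with respect to the first is exp(cx + d). Jensen's inequality for
`φ` plus this exponent, under the first law, suffices, since the exponent has mean -(a - b)²/(2v).
-/
theorem gaussianReal (a b : ℝ) {v : ℝ≥0} (hv : v ≠ 0) :
    EntropyBound (gaussianReal a v) (gaussianReal b v) ((a - b) ^ 2 / (2 * v)) := by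
  rintro φ hφ ⟨C, hC⟩
  have hv' : (v : ℝ) ≠ 0 := by exact_mod_cast hv
  set c : ℝ := (b - a) / v with hc
  set d : ℝ := (a ^ 2 - b ^ 2) / (2 * v) with hd
  have hexp : Integrable (fun x => Real.exp (φ x + (c * x + d)))
      (ProbabilityTheory.gaussianReal a v) := by
    have h1 : Integrable (fun x => Real.exp d * Real.exp (c * x))
        (ProbabilityTheory.gaussianReal a v) :=
      (integrable_exp_mul_gaussianReal c).const_mul _
    refine (h1.bdd_mul hφ.exp.aestronglyMeasurable (c := Real.exp C) (ae_of_all _ fun x => ?_)).congr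
      (ae_of_all _ fun x => ?_)
    · rw [Real.norm_eq_abs, abs_of_pos (Real.exp_pos _)]
      exact Real.exp_le_exp.2 (abs_le.1 (hC x)).2
    · simp only [← Real.exp_add]; congr 1; ring
  have hid : Integrable (fun x : ℝ => x) (ProbabilityTheory.gaussianReal a v) :=
    (memLp_id_gaussianReal 1).integrable (by simp)
  have haff : Integrable (fun x => c * x + d) (ProbabilityTheory.gaussianReal a v) :=
    (hid.const_mul c).add (integrable_const d)
  have hφi : Integrable φ (ProbabilityTheory.gaussianReal a v) := integrable_of_abs_le hφ hC
  have hQ : ∫ x, Real.exp (φ x) ∂ProbabilityTheory.gaussianReal b v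
      = ∫ x, Real.exp (φ x + (c * x + d)) ∂ProbabilityTheory.gaussianReal a v := by
    rw [integral_gaussianReal_eq_integral_smul hv, integral_gaussianReal_eq_integral_smul hv]
    refine integral_congr_ae (ae_of_all _ fun x => ?_)
    simp only [gaussianPDFReal, smul_eq_mul, mul_assoc, ← Real.exp_add]
    congr 2
    rw [hc, hd]
    field_simp
    ring
  have hj := convexOn_exp.map_integral_le Real.continuous_exp.continuousOn isClosed_univ (by simp)
    (hφi.add haff) hexp
  have hlog := (Real.le_log_iff_exp_le ((Real.exp_pos _).trans_le hj)).2 hj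
  simp only [Pi.add_apply] at hlog
  rw [integral_add hφi haff, integral_add (hid.const_mul c) (integrable_const d),
    integral_const_mul, integral_id_gaussianReal] at hlog
  have hval : c * a + d = -((a - b) ^ 2 / (2 * v)) := by
    rw [hc, hd]; field_simp; ring
  rw [hQ]
  simp only [integral_const, probReal_univ, smul_eq_mul, one_mul] at hlog
  linarith

/-- Two normal laws on `ℝⁿ` with covariance `σ² I`. -/
theorem gaussianVec {n : ℕ} (a b : Rn n) {σ : ℝ≥0} (hσ : σ ≠ 0) :
    EntropyBound ((gaussianVec n σ).map (a + ·)) ((gaussianVec n σ).map (b + ·))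
      (‖a - b‖ ^ 2 / (2 * σ ^ 2)) := by
  -- A shifted isotropic Gaussian is a product of real Gaussians, so the coordinate entropies add up
  -- to the squared norm.
  have key : ∀ c : Rn n, (_root_.gaussianVec n σ).map (c + ·) =
      (Measure.pi fun i => ProbabilityTheory.gaussianReal (c i) (σ ^ 2)).map (WithLp.toLp 2) := by
    intro c
    have hpi : (Measure.pi fun i => ProbabilityTheory.gaussianReal (c i) (σ ^ 2)) =
        (Measure.pi fun _ : Fin n => ProbabilityTheory.gaussianReal 0 1).map
          (fun z i => c i + σ * z i) := by
      rw [Measure.pi_map_pi (f := fun i z => c i + (σ : ℝ) * z) fun i => by fun_prop]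
      congr 1
      ext1 i
      have : (fun z : ℝ => c i + (σ : ℝ) * z) = (fun z => c i + z) ∘ fun z => (σ : ℝ) * z := rfl
      rw [this, ← Measure.map_map (by fun_prop) (by fun_prop), gaussianReal_map_const_mul,
        gaussianReal_map_const_add]
      congr 1
      · simp
      · ext; simp
    rw [hpi, _root_.gaussianVec, ← map_pi_eq_stdGaussian,
      Measure.map_map (by fun_prop) (by fun_prop),
      Measure.map_map (by fun_prop) (by fun_prop), Measure.map_map (by fun_prop) (by fun_prop)]
    congr 1
  rw [key, key, EuclideanSpace.norm_sq_eq, Finset.sum_div]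
  refine EntropyBound.map ?_ (by fun_prop)
  refine EntropyBound.pi fun i => ?_
  have := EntropyBound.gaussianReal (a i) (b i) (v := σ ^ 2) (by positivity)
  simpa using this

/-- An event of `P`-probability at least `p` and `Q`-probability at most `1 / M` forces the
relative entropy to be at least `p log M - log 2`. -/
theorem mul_log_le {P Q : Measure α} [IsProbabilityMeasure P] [IsProbabilityMeasure Q] {D : ℝ}
    (h : EntropyBound P Q D) {A : Set α} (hA : MeasurableSet A) {M p : ℝ} (hM : 1 ≤ M)
    (hP : p ≤ P.real A) (hQ : M * Q.real A ≤ 1) : p * Real.log M ≤ D + Real.log 2 := by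
  have hlog : 0 ≤ Real.log M := Real.log_nonneg hM
  -- With this test function the exponential moment is 1 + (M - 1) Q(A) ≤ 2, the source of log 2.
  have h1 := h (A.indicator fun _ => Real.log M) (measurable_const.indicator hA)
    ⟨Real.log M, fun x => by
      by_cases hx : x ∈ A <;> simp [hx, abs_of_nonneg hlog, hlog]⟩
  have h2 : (fun x => Real.exp (A.indicator (fun _ => Real.log M) x)) =
      fun x => 1 + A.indicator (fun _ => M - 1) x := by
    ext x
    by_cases hx : x ∈ A
    · simp [hx, Real.exp_log (zero_lt_one.trans_le hM)]
    · simp [hx]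
  rw [h2, integral_add (integrable_const _) ((integrable_const _).indicator hA),
    integral_indicator_const _ hA, integral_indicator_const _ hA] at h1
  simp only [integral_const, probReal_univ, smul_eq_mul, one_mul] at h1
  have hq : 0 ≤ Q.real A := measureReal_nonneg
  have h3 : Real.log (1 + Q.real A * (M - 1)) ≤ Real.log 2 :=
    Real.log_le_log (by nlinarith) (by nlinarith)
  nlinarith

end EntropyBound

/-! ### Binary codes and cube vertices -/

/-- The sum factors over coordinates, each contributing 1 + 1/2. -/
theorem sum_half_pow_hammingDist {n : ℕ} (v : Fin n → Bool) :
    ∑ w : Fin n → Bool, (1 / 2 : ℝ) ^ hammingDist v w = (3 / 2) ^ n := by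
  have h : ∀ w : Fin n → Bool, (1 / 2 : ℝ) ^ hammingDist v w =
      ∏ i, if v i ≠ w i then (1 / 2 : ℝ) else 1 := fun w => by
    rw [hammingDist, ← Finset.prod_const, Finset.prod_filter]
  simp_rw [h]
  rw [← Fintype.prod_sum fun i (b : Bool) => if v i ≠ b then (1 / 2 : ℝ) else 1]
  have h2 : ∀ i, (∑ b : Bool, if v i ≠ b then (1 / 2 : ℝ) else 1) = 3 / 2 := fun i => by
    cases v i <;> norm_num
  simp only [h2, Finset.prod_const, Finset.card_univ, Fintype.card_fin]

/-- A Chernoff bound: each word of the ball has weight at least 2^(-n/8) in the preceding sum. -/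
theorem card_hammingBall_le {n : ℕ} (v : Fin n → Bool) :
    (({w | 8 * hammingDist v w < n} : Finset (Fin n → Bool)).card : ℝ) ≤
      (3 / 2) ^ n * (2 : ℝ) ^ ((n : ℝ) / 8) := by
  have ht : 0 < (2 : ℝ) ^ ((n : ℝ) / 8) := by positivity
  rw [← div_le_iff₀ ht, ← sum_half_pow_hammingDist v, div_eq_mul_inv, ← nsmul_eq_mul,
    ← Finset.sum_const]
  refine (Finset.sum_le_sum fun w hw => ?_).trans
    (Finset.sum_le_sum_of_subset_of_nonneg (Finset.subset_univ _) fun _ _ _ => by positivity)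
  have hw' : 8 * hammingDist v w < n := by simpa using hw
  have hw'' : 8 * (hammingDist v w : ℝ) < n := by exact_mod_cast hw'
  rw [one_div, inv_pow, ← Real.rpow_natCast]
  gcongr
  · norm_num
  · linarith

/-- The Gilbert–Varshamov bound for binary codes of relative distance `1 / 8`. -/
theorem exists_binaryCode {n : ℕ} (hn : 0 < n) : ∃ V : Finset (Fin n → Bool),
    (∀ v ∈ V, ∀ w ∈ V, v ≠ w → n ≤ 8 * hammingDist v w) ∧ (2 : ℝ) ^ ((n : ℝ) / 8) ≤ V.card := by
  classical
  -- A code of maximal size: a word outside all its balls could be added, so the balls cover the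
  -- cube.
  obtain ⟨V, hV, hmax⟩ := Finset.exists_max_image
    (Finset.univ.filter fun V : Finset (Fin n → Bool) =>
      ∀ v ∈ V, ∀ w ∈ V, v ≠ w → n ≤ 8 * hammingDist v w) Finset.card ⟨∅, by simp⟩
  have hV' : ∀ v ∈ V, ∀ w ∈ V, v ≠ w → n ≤ 8 * hammingDist v w := by simpa using hV
  refine ⟨V, hV', ?_⟩
  have hcover : ∀ w : Fin n → Bool, ∃ v ∈ V, 8 * hammingDist v w < n := by
    intro w
    by_contra! hw
    have hwV : w ∉ V := fun h => by
      have := hw w h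
      rw [hammingDist_self] at this
      omega
    have hins := hmax (insert w V) (by
      simp only [Finset.mem_filter, Finset.mem_univ, true_and]
      intro a ha b hb hab
      rcases Finset.mem_insert.1 ha with haw | haV <;> rcases Finset.mem_insert.1 hb with hbw | hbV
      · exact absurd (haw.trans hbw.symm) hab
      · rw [haw, hammingDist_comm]; exact hw b hbV
      · rw [hbw]; exact hw a haV
      · exact hV' a haV b hbV hab)
    rw [Finset.card_insert_of_notMem hwV] at hins
    omega
  set t : ℝ := (2 : ℝ) ^ ((n : ℝ) / 8) with htdef
  have ht : 0 < t := by positivity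
  have ht8 : t ^ 8 = 2 ^ n := by
    rw [htdef, ← Real.rpow_natCast, ← Real.rpow_mul (by norm_num), ← Real.rpow_natCast]
    congr 1
    push_cast
    ring
  have hcard : (2 : ℝ) ^ n ≤ V.card * ((3 / 2) ^ n * t) := by
    have hsub : (Finset.univ : Finset (Fin n → Bool)) ⊆
        V.biUnion fun v => {w | 8 * hammingDist v w < n} := fun w _ => by
      obtain ⟨v, hv, hvw⟩ := hcover w
      exact Finset.mem_biUnion.2 ⟨v, hv, by simpa using hvw⟩
    have h1 := (Finset.card_le_card hsub).trans Finset.card_biUnion_le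
    have h2 : (2 : ℝ) ^ n ≤
        ∑ v ∈ V, (({w | 8 * hammingDist v w < n} : Finset (Fin n → Bool)).card : ℝ) := by
      have : Fintype.card (Fin n → Bool) = 2 ^ n := by simp
      rw [Finset.card_univ, this] at h1
      exact_mod_cast h1
    refine h2.trans ((Finset.sum_le_sum fun v _ => card_hammingBall_le v).trans ?_)
    rw [Finset.sum_const, nsmul_eq_mul]
  -- This is 3/2 ≤ 2^(3/4), from (3/2)⁴ = 81/16 ≤ 8. A ball then has at most t⁷ of the t⁸ words.
  have h6 : (3 / 2 : ℝ) ^ n ≤ t ^ 6 := by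
    refine le_of_pow_le_pow_left₀ (n := 4) (by norm_num) (by positivity) ?_
    calc ((3 / 2 : ℝ) ^ n) ^ 4 = (81 / 16) ^ n := by rw [← pow_mul, mul_comm, pow_mul]; norm_num
      _ ≤ 8 ^ n := by gcongr; norm_num
      _ = (t ^ 8) ^ 3 := by rw [ht8, ← pow_mul, mul_comm, pow_mul]; norm_num
      _ = (t ^ 6) ^ 4 := by ring
  have h7 : t * t ^ 7 ≤ V.card * t ^ 7 := by
    calc t * t ^ 7 = 2 ^ n := by rw [← ht8]; ring
      _ ≤ V.card * ((3 / 2) ^ n * t) := hcard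
      _ ≤ V.card * (t ^ 6 * t) := by gcongr
      _ = V.card * t ^ 7 := by ring
  exact le_of_mul_le_mul_right h7 (by positivity)

/-- The vertex of the cube `[-1, 1]ⁿ` with sign pattern `v`. -/
noncomputable def cubeVertex {n : ℕ} (v : Fin n → Bool) : Rn n :=
  WithLp.toLp 2 fun i => if v i then 1 else -1

theorem norm_sq_cubeVertex_sub {n : ℕ} (v w : Fin n → Bool) :
    ‖cubeVertex v - cubeVertex w‖ ^ 2 = 4 * hammingDist v w := by
  rw [EuclideanSpace.real_norm_sq_eq, hammingDist, Finset.card_filter]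
  push_cast
  rw [Finset.mul_sum]
  refine Finset.sum_congr rfl fun i _ => ?_
  simp only [cubeVertex, PiLp.sub_apply]
  cases v i <;> cases w i <;> norm_num

/-! ### Oracle kernels, adaptive histories and Fano's inequality -/

theorem additiveNoise_apply {α β : Type*} [MeasurableSpace α] [MeasurableSpace β] [Add β]
    [MeasurableAdd₂ β] (ψ : α → β) (hψ : Measurable ψ) (ν : Measure β) [SFinite ν] (x : α) :
    additiveNoise ψ hψ ν x = ν.map (ψ x + ·) := by
  rw [additiveNoise, Kernel.map_apply _ (by fun_prop), Kernel.prod_apply,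
    Kernel.deterministic_apply, Kernel.const_apply, Measure.dirac_prod,
    Measure.map_map (by fun_prop) (by fun_prop)]
  rfl

theorem EntropyBound.additiveNoise {α β : Type*} [MeasurableSpace α] [MeasurableSpace β] [Add β]
    [MeasurableAdd₂ β] {ψ ψ' : α → β} (hψ : Measurable ψ) (hψ' : Measurable ψ') {ν : Measure β}
    [SFinite ν] {x : α} {D : ℝ} (h : EntropyBound (ν.map (ψ x + ·)) (ν.map (ψ' x + ·)) D) :
    EntropyBound (_root_.additiveNoise ψ hψ ν x) (_root_.additiveNoise ψ' hψ' ν x) D := by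
  rwa [additiveNoise_apply, additiveNoise_apply]

namespace Algorithm

variable {n : ℕ} {P : ProblemClass n} {T : ℕ}

theorem measurable_appendQuery (A : Algorithm P T) (t : ℕ) (ht : t + 1 ≤ T) :
    Measurable fun p : (Fin t → P.domain × P.Info) × P.Info =>
      (Fin.snoc (α := fun _ => P.domain × P.Info) p.1 (A.next ⟨t, by omega⟩ p.1, p.2) :
        Fin (t + 1) → P.domain × P.Info) := by
  refine measurable_pi_iff.2 fun i => ?_
  refine Fin.lastCases ?_ (fun j => ?_) i
  · simp only [Fin.snoc_last]
    exact ((A.measurable_next ⟨t, by omega⟩).comp measurable_fst).prodMk measurable_snd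
  · simp only [Fin.snoc_castSucc]
    exact (measurable_pi_apply j).comp measurable_fst

theorem isProbabilityMeasure_historyLaw (A : Algorithm P T) (f : P.instances) (t : ℕ)
    (ht : t ≤ T) : IsProbabilityMeasure (A.historyLaw f t ht) := by
  induction t with
  | zero => rw [historyLaw]; infer_instance
  | succ t ih =>
    have := ih (by omega)
    rw [historyLaw]
    exact Measure.isProbabilityMeasure_map (A.measurable_appendQuery t ht).aemeasurable

/-- If each oracle response carries information at most `D` for telling `f` from `f'`, then `t`
adaptive responses carry at most `t * D`. -/
theorem entropyBound_historyLaw (A : Algorithm P T) (f f' : P.instances) {D : ℝ}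
    (h : ∀ x, EntropyBound (P.oracle f x) (P.oracle f' x) D) (t : ℕ) (ht : t ≤ T) :
    EntropyBound (A.historyLaw f t ht) (A.historyLaw f' t ht) (t * D) := by
  induction t with
  | zero =>
    rw [historyLaw, historyLaw, Nat.cast_zero, zero_mul]
    exact EntropyBound.refl _
  | succ t ih =>
    have := A.isProbabilityMeasure_historyLaw f t (by omega)
    have := A.isProbabilityMeasure_historyLaw f' t (by omega)
    rw [historyLaw, historyLaw, Nat.cast_add, Nat.cast_one, add_mul, one_mul]
    -- Both laws use the same query rule and `h` is uniform in the query, so adaptivity costs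
    -- nothing.
    exact ((ih (Nat.le_of_succ_le ht)).compProd fun x => by
      simpa only [Kernel.comap_apply] using h _).map (A.measurable_appendQuery t ht)

end Algorithm

/-- Fano's inequality: if the `|V|` instances `f v` cannot be solved simultaneously and each oracle
response carries information at most `D` for telling two of them apart, then `T` oracle calls do
not suffice unless `T * D` is of the order of `log |V|`. -/
theorem Algorithm.log_card_le {n : ℕ} {P : ProblemClass n} {T : ℕ} (A : Algorithm P T) {ι : Type*}
    (V : Finset ι) (hV : V.Nonempty) (f : ι → P.instances) {r ε δ D : ℝ} (hδ : 0 ≤ δ)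
    (hA : ⨆ f : P.instances, A.failureProb f r ε ≤ ENNReal.ofReal δ)
    (hmeas : ∀ v, Measurable (f v).1)
    (hsep : ∀ v ∈ V, ∀ w ∈ V, v ≠ w → ∀ x, ((f v).1 x - ⨅ x, (f v).1 x) ^ r < ε →
      ε ≤ ((f w).1 x - ⨅ x, (f w).1 x) ^ r)
    (hD : ∀ v w x, EntropyBound (P.oracle (f v) x) (P.oracle (f w) x) D) :
    (1 - δ) * Real.log V.card ≤ T * D + Real.log 2 := by
  obtain ⟨v₀, hv₀⟩ := hV
  set S : ι → Set (Fin T → P.domain × P.Info) := fun v => {h | A.err (f v) h ^ r < ε}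
  have hS : ∀ v, MeasurableSet (S v) := fun v => by
    refine measurableSet_lt ?_ measurable_const
    exact (((hmeas v).comp (A.measurable_next (Fin.last T))).sub measurable_const).pow_const r
  have hprob : ∀ v, IsProbabilityMeasure (A.historyLaw (f v) T le_rfl) := fun v =>
    A.isProbabilityMeasure_historyLaw _ _ _
  have hsucc : ∀ v, 1 - δ ≤ (A.historyLaw (f v) T le_rfl).real (S v) := fun v => by
    have hc : (S v)ᶜ = {h | ε ≤ A.err (f v) h ^ r} := by ext; simp [S]
    have h1 : (A.historyLaw (f v) T le_rfl).real (S v)ᶜ ≤ δ := by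
      rw [hc]
      exact ENNReal.toReal_le_of_le_ofReal hδ
        ((le_iSup (fun f => A.failureProb f r ε) (f v)).trans hA)
    rw [probReal_compl_eq_one_sub (hS v)] at h1
    linarith
  have hdisj : (V : Set ι).PairwiseDisjoint S := fun v hv w hw hvw =>
    Set.disjoint_left.2 fun h h1 h2 => (hsep v hv w hw hvw _ h1).not_gt h2
  have hsum : ∑ v ∈ V, (A.historyLaw (f v₀) T le_rfl).real (S v) ≤ 1 := by
    rw [← measureReal_biUnion_finset hdisj fun v _ => hS v]
    exact measureReal_le_one
  have hcard : 0 < (V.card : ℝ) := by exact_mod_cast Finset.card_pos.2 ⟨v₀, hv₀⟩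
  -- Pigeonhole: the success events are disjoint, so one has probability at most 1/|V| under the law
  -- of `f v₀`. The case v = v₀ needs no exclusion.
  obtain ⟨v, hv, hle⟩ := Finset.exists_le_of_sum_le (g := fun _ => 1 / (V.card : ℝ)) ⟨v₀, hv₀⟩
    (hsum.trans_eq (by rw [Finset.sum_const, nsmul_eq_mul, mul_one_div_cancel hcard.ne']))
  rw [le_div_iff₀ hcard, mul_comm] at hle
  exact (A.entropyBound_historyLaw (f v) (f v₀) (hD v v₀) T le_rfl).mul_log_le (hS v)
    (by exact_mod_cast Finset.card_pos.2 ⟨v₀, hv₀⟩) (hsucc v) hle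

/-! ### Subgradient bounds and cones -/

/-- Testing at x + g gives ‖g‖² ≤ F(x + g) - F(x) ≤ L‖g‖. The point may leave X, hence the extension
to the whole space. -/
theorem norm_le_of_isSubgradient {n : ℕ} {F : Rn n → ℝ} {L : ℝ≥0} (hF : LipschitzWith L F)
    {x g : Rn n} (hg : IsSubgradient F x g) : ‖g‖ ≤ L := by
  rcases eq_or_ne g 0 with rfl | h0
  · simp
  have h1 := hg (x + g)
  have h2 := (le_abs_self _).trans (hF.dist_le_mul (x + g) x)
  rw [add_sub_cancel_left, real_inner_self_eq_norm_sq] at h1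
  rw [dist_eq_norm, add_sub_cancel_left] at h2
  have h3 : 0 < ‖g‖ := norm_pos_iff.2 h0
  nlinarith

/-- The cone `x ↦ L ‖x - c‖`, restricted to `X`. -/
noncomputable def coneFun {n : ℕ} (X : Set (Rn n)) (L : ℝ≥0) (c : Rn n) (x : X) : ℝ :=
  L * ‖(x : Rn n) - c‖

theorem lipschitzWith_coneFun {n : ℕ} (X : Set (Rn n)) (L : ℝ≥0) (c : Rn n) :
    LipschitzWith L (coneFun X L c) := by
  refine LipschitzWith.of_dist_le_mul fun x y => ?_
  rw [Real.dist_eq, coneFun, coneFun, ← mul_sub, abs_mul, NNReal.abs_eq, Subtype.dist_eq,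
    dist_eq_norm]
  gcongr
  simpa using abs_norm_sub_norm_le ((x : Rn n) - c) (y - c)

theorem coneFun_mem_lipClass {n : ℕ} (X : Set (Rn n)) {L : ℝ≥0} (hL : L ≤ 1) (c : Rn n) :
    coneFun X L c ∈ lipClass X := by
  refine ⟨fun x y z a b ha hb hab hz => ?_, (lipschitzWith_coneFun X L c).weaken hL⟩
  have h1 : (z : Rn n) - c = a • ((x : Rn n) - c) + b • ((y : Rn n) - c) := by
    rw [hz, smul_sub, smul_sub]
    nth_rw 1 [← one_smul ℝ c, ← hab, add_smul]
    abel
  have h2 := norm_add_le (a • ((x : Rn n) - c)) (b • ((y : Rn n) - c))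
  rw [norm_smul, norm_smul, Real.norm_of_nonneg ha, Real.norm_of_nonneg hb] at h2
  calc coneFun X L c z = L * ‖a • ((x : Rn n) - c) + b • ((y : Rn n) - c)‖ := by rw [coneFun, h1]
    _ ≤ L * (a * ‖(x : Rn n) - c‖ + b * ‖(y : Rn n) - c‖) := by gcongr
    _ = a * coneFun X L c x + b * coneFun X L c y := by simp only [coneFun]; ring

theorem abs_coneFun_sub_le {n : ℕ} (X : Set (Rn n)) (L : ℝ≥0) (c d : Rn n) (x : X) :
    |coneFun X L c x - coneFun X L d x| ≤ L * ‖c - d‖ := by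
  rw [coneFun, coneFun, ← mul_sub, abs_mul, NNReal.abs_eq]
  gcongr
  have := abs_norm_sub_norm_le ((x : Rn n) - c) (x - d)
  rwa [sub_sub_sub_cancel_left, norm_sub_rev d c] at this

theorem iInf_coneFun {n : ℕ} {X : Set (Rn n)} (L : ℝ≥0) {c : Rn n} (hc : c ∈ X) :
    ⨅ x, coneFun X L c x = 0 := by
  have h0 : ∀ x, 0 ≤ coneFun X L c x := fun x => by unfold coneFun; positivity
  have : Nonempty X := ⟨⟨c, hc⟩⟩
  refine le_antisymm ?_ (le_ciInf h0)
  refine (ciInf_le ⟨0, by rintro _ ⟨x, rfl⟩; exact h0 x⟩ (⟨c, hc⟩ : X)).trans_eq ?_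
  simp [coneFun]

namespace SubgradientSelector

variable {n : ℕ} {X : Set (Rn n)} (g : SubgradientSelector X)

theorem norm_grad_le (f : lipClass X) {L : ℝ≥0} (hf : LipschitzWith L f.1) (x : X) :
    ‖g.grad f x‖ ≤ L := by
  obtain ⟨F, hF, hsub⟩ := g.isSubgradient f
  exact norm_le_of_isSubgradient (hF.lipschitz L hf) (hsub x)

theorem norm_grad_sub_le (f f' : lipClass X) {L : ℝ≥0} (hf : LipschitzWith L f.1)
    (hf' : LipschitzWith L f'.1) (x : X) : ‖g.grad f x - g.grad f' x‖ ≤ 2 * L := by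
  have := norm_sub_le (g.grad f x) (g.grad f' x)
  have := g.norm_grad_le f hf x
  have := g.norm_grad_le f' hf' x
  linarith

end SubgradientSelector

/-! ### Information in one oracle response -/

theorem entropyBound_lipSOG {n : ℕ} {X : Set (Rn n)} (hX : IsCompact X) (hX' : Convex ℝ X)
    (g : SubgradientSelector X) {σ : ℝ≥0} (hσ : σ ≠ 0) (f f' : lipClass X) {G : ℝ} (x : X)
    (hG : ‖g.grad f x - g.grad f' x‖ ≤ G) :
    EntropyBound ((lipSOG X hX hX' g σ).oracle f x) ((lipSOG X hX hX' g σ).oracle f' x)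
      (G ^ 2 / (2 * σ ^ 2)) := by
  exact .additiveNoise (α := X) (β := Rn n) (g.measurable_grad f) (g.measurable_grad f')
    ((EntropyBound.gaussianVec _ _ hσ).mono (by gcongr))

theorem entropyBound_lipFOG {n : ℕ} {X : Set (Rn n)} (hX : IsCompact X) (hX' : Convex ℝ X)
    (g : SubgradientSelector X) {σ : ℝ≥0} (hσ : σ ≠ 0) (f f' : lipClass X) {B G : ℝ} (x : X)
    (hB : |f.1 x - f'.1 x| ≤ B) (hG : ‖g.grad f x - g.grad f' x‖ ≤ G) :
    EntropyBound ((lipFOG X hX hX' g σ).oracle f x) ((lipFOG X hX hX' g σ).oracle f' x)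
      ((B ^ 2 + G ^ 2) / (2 * σ ^ 2)) := by
  refine .additiveNoise (α := X) (β := ℝ × Rn n)
    (f.2.2.continuous.measurable.prodMk (g.measurable_grad f))
    (f'.2.2.continuous.measurable.prodMk (g.measurable_grad f')) ?_
  -- A shift of the product noise is a product of shifts, so the value and subgradient entropies
  -- add.
  have hmap : ∀ p : ℝ × Rn n,
      ((gaussianReal 0 (σ ^ 2)).prod (gaussianVec n σ)).map (p + ·) =
        (gaussianReal p.1 (σ ^ 2)).prod ((gaussianVec n σ).map (p.2 + ·)) := fun p => by
    have h1 : gaussianReal p.1 (σ ^ 2) = (gaussianReal 0 (σ ^ 2)).map (p.1 + ·) := by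
      rw [gaussianReal_map_const_add, zero_add]
    rw [h1, Measure.map_prod_map _ _ (by fun_prop) (by fun_prop)]
    rfl
  rw [hmap, hmap]
  have : ∀ c : Rn n, IsProbabilityMeasure ((gaussianVec n σ).map (c + ·)) := fun c =>
    Measure.isProbabilityMeasure_map (by fun_prop)
  refine ((EntropyBound.gaussianReal (f.1 x) (f'.1 x) (v := σ ^ 2) (by positivity)).prod
    (EntropyBound.gaussianVec (g.grad f x) (g.grad f' x) hσ)).mono ?_
  rw [add_div, NNReal.coe_pow, ← sq_abs (f.1 x - f'.1 x)]
  gcongr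

/-! ### Hard instances and the complexity bounds -/

theorem le_complexity {n : ℕ} (P : ProblemClass n) {r ε δ b : ℝ}
    (h : ∀ (T : ℕ) (A : Algorithm P T),
      ⨆ f : P.instances, A.failureProb f r ε ≤ ENNReal.ofReal δ → b ≤ T) :
    (b : EReal) ≤ ((complexity P r ε δ : ℝ≥0∞) : EReal) := by
  rcases Set.eq_empty_or_nonempty {K : ℕ∞ | ∃ T : ℕ, 1 ≤ T ∧ K = T ∧
    ∃ A : Algorithm P T, ⨆ f : P.instances, A.failureProb f r ε ≤ ENNReal.ofReal δ} with h0 | h0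
  · rw [complexity, h0]
    simp
  · obtain ⟨T, -, hT, A, hA⟩ := csInf_mem h0
    rw [complexity, hT]
    have : ((((T : ℕ∞) : ℝ≥0∞)) : EReal) = ((T : ℝ) : EReal) := by
      rw [ENat.toENNReal_coe]; rfl
    rw [this]
    exact EReal.coe_le_coe_iff.2 (h T A hA)

/-- Two cones with the same slope and far apart apexes have no common approximate minimizer. -/
theorem le_coneFun_of_lt {n : ℕ} {X : Set (Rn n)} {L : ℝ≥0} {c d : Rn n} {η : ℝ}
    (h : 2 * η ≤ L * ‖c - d‖) {x : X} (hx : coneFun X L c x < η) : η ≤ coneFun X L d x := by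
  have h2 : ‖c - d‖ ≤ ‖(x : Rn n) - c‖ + ‖(x : Rn n) - d‖ := by
    rw [norm_sub_rev (x : Rn n) c]
    simpa using norm_add_le (c - (x : Rn n)) (x - d)
  have h3 : (L : ℝ) * ‖c - d‖ ≤ L * (‖(x : Rn n) - c‖ + ‖(x : Rn n) - d‖) := by gcongr
  unfold coneFun at *
  linarith

/-- A family of hard instances: `2 ^ (n / 8)` cones with apexes at vertices of a cube in `X`. -/
theorem exists_coneFamily {n : ℕ} (hn : 0 < n) {X : Set (Rn n)} {s η : ℝ} (hs : 0 < s)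
    (hsX : {x : Rn n | ∀ i, |x i| ≤ s} ⊆ X) (hη : 0 < η) (hη' : η ≤ s * √((n : ℝ) / 8)) :
    ∃ (L : ℝ≥0) (V : Finset (Fin n → Bool)) (c : (Fin n → Bool) → Rn n),
      L ≤ 1 ∧ (L : ℝ) ^ 2 * (n * s ^ 2) = 8 * η ^ 2 ∧ (2 : ℝ) ^ ((n : ℝ) / 8) ≤ V.card ∧
      (∀ v, c v ∈ X) ∧ (∀ v w, ‖c v - c w‖ ^ 2 ≤ 4 * (n * s ^ 2)) ∧
      ∀ v ∈ V, ∀ w ∈ V, v ≠ w → 2 * η ≤ L * ‖c v - c w‖ := by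
  obtain ⟨V, hV, hcard⟩ := exists_binaryCode hn
  have hn' : (0 : ℝ) < n := by exact_mod_cast hn
  have hq : 0 < √((n : ℝ) / 8) := by positivity
  have hq2 : √((n : ℝ) / 8) ^ 2 = n / 8 := Real.sq_sqrt (by positivity)
  -- Code distance n/8 puts distinct apexes at least 2s√(n/8) apart; this slope turns that gap into
  -- 2η.
  obtain ⟨L, hL_eq⟩ : ∃ L : ℝ≥0, (L : ℝ) = η / (s * √((n : ℝ) / 8)) :=
    ⟨.mk (η / (s * √((n : ℝ) / 8))) (by positivity), rfl⟩
  have hL : (L : ℝ) ^ 2 * (n * s ^ 2) = 8 * η ^ 2 := by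
    rw [hL_eq, div_pow, mul_pow, hq2]
    field_simp
  have hdist : ∀ v w : Fin n → Bool,
      ‖s • cubeVertex v - s • cubeVertex w‖ ^ 2 = s ^ 2 * (4 * hammingDist v w) := fun v w => by
    rw [← smul_sub, norm_smul, mul_pow, norm_sq_cubeVertex_sub, Real.norm_eq_abs, sq_abs]
  refine ⟨L, V, fun v => s • cubeVertex v, ?_, hL, hcard,
    fun v => hsX fun i => ?_, fun v w => ?_, fun v hv w hw hvw => ?_⟩
  · rw [← NNReal.coe_le_coe, hL_eq]
    exact (div_le_one (by positivity)).2 hη'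
  · cases h : v i <;> simp [cubeVertex, h, abs_of_pos hs]
  · have : (hammingDist v w : ℝ) ≤ n := by
      exact_mod_cast hammingDist_le_card_fintype.trans_eq (Fintype.card_fin n)
    rw [hdist]
    nlinarith [sq_nonneg s]
  · have h8 : (n : ℝ) ≤ 8 * hammingDist v w := by exact_mod_cast hV v hv w hw hvw
    refine le_of_sq_le_sq ?_ (by positivity)
    rw [mul_pow _ ‖_‖, hdist]
    have hL2 : 0 ≤ (L : ℝ) ^ 2 * s ^ 2 := by positivity
    nlinarith

theorem theorem2 (n : ℕ) (hn : 16 ≤ n)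
    (X : Set (Rn n)) (hX : IsCompact X) (hX' : Convex ℝ X)
    (g : SubgradientSelector X) (σ : ℝ≥0)
    (r ε δ : ℝ) (hr : 1 ≤ r)
    (hε : 0 < ε) (hε' : ε ≤ (cubeRadius X * √((n : ℝ) / 8)) ^ r)
    (hδ : 0 < δ) (hδ' : δ < 1 / 2) :
    (((((1 - δ) * n - 8) * n * cubeRadius X ^ 2 * Real.log 2
          / (128 * (n * cubeRadius X ^ 2 + 1))
          * ((σ : ℝ) ^ 2 / ε ^ (2 / r)) : ℝ) : EReal)
        ≤ ((complexity (lipFOG X hX hX' g σ) r ε δ : ℝ≥0∞) : EReal)) ∧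
    (((((1 - δ) * n - 8) * n * cubeRadius X ^ 2 * Real.log 2
          / 128
          * ((σ : ℝ) ^ 2 / ε ^ (2 / r)) : ℝ) : EReal)
        ≤ ((complexity (lipSOG X hX hX' g σ) r ε δ : ℝ≥0∞) : EReal)) := by
  rcases eq_or_ne σ 0 with rfl | hσ
  · simp only [NNReal.coe_zero, ne_eq, OfNat.ofNat_ne_zero, not_false_eq_true, zero_pow, zero_div,
      mul_zero, EReal.coe_zero]
    exact ⟨EReal.coe_ennreal_nonneg _, EReal.coe_ennreal_nonneg _⟩
  have hr0 : 0 < r := by linarith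
  have hn0 : (0 : ℝ) < n := by exact_mod_cast (by omega : 0 < n)
  have hσ0 : 0 < (σ : ℝ) := by exact_mod_cast pos_iff_ne_zero.2 hσ
  set s := cubeRadius X with hs_def
  have hs_nonneg : 0 ≤ s := Real.sSup_nonneg fun t ht => ht.1
  have hs : 0 < s := hs_nonneg.lt_of_ne fun h => by
    rw [← h, zero_mul, Real.zero_rpow hr0.ne'] at hε'
    linarith
  -- Otherwise no cube fits and `sSup ∅ = 0` contradicts s > 0.
  have h0X : (0 : Rn n) ∈ X := by
    by_contra h0
    refine hs.ne' (hs_def.trans ?_)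
    rw [cubeRadius, Set.eq_empty_of_forall_notMem (s := {s : ℝ | _}), Real.sSup_empty]
    exact fun t ht => h0 (ht.2 fun i => by simpa using ht.1)
  have hsX := (isGreatest_cubeRadius (by omega : 0 < n) hX h0X).1.2
  set η := ε ^ (1 / r) with hη_def
  have hη : 0 < η := Real.rpow_pos_of_pos hε _
  have hη2 : ε ^ (2 / r) = η ^ 2 := by
    rw [hη_def, ← Real.rpow_natCast, ← Real.rpow_mul hε.le]
    congr 1
    push_cast
    ring
  have hηr : η ^ r = ε := by
    rw [hη_def, ← Real.rpow_mul hε.le, one_div_mul_cancel hr0.ne', Real.rpow_one]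
  have hη' : η ≤ s * √((n : ℝ) / 8) := by
    rw [← hηr] at hε'
    exact (Real.rpow_le_rpow_iff hη.le (by positivity) hr0).1 hε'
  obtain ⟨L, V, c, hL1, hL, hV, hcX, hdist, hsep⟩ := exists_coneFamily (by omega) hs hsX hη hη'
  have hVne : V.Nonempty := by
    rw [← Finset.card_pos, ← Nat.cast_pos (α := ℝ)]
    exact (by positivity : (0 : ℝ) < (2 : ℝ) ^ ((n : ℝ) / 8)).trans_le hV
  let f : (Fin n → Bool) → lipClass X := fun v => ⟨coneFun X L (c v), coneFun_mem_lipClass X hL1 _⟩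
  have hLip : ∀ v, LipschitzWith L (f v).1 := fun v => lipschitzWith_coneFun X L (c v)
  have hmeas : ∀ v, Measurable (f v).1 := fun v => (hLip v).continuous.measurable
  have hsep' : ∀ v ∈ V, ∀ w ∈ V, v ≠ w → ∀ x, ((f v).1 x - ⨅ x, (f v).1 x) ^ r < ε →
      ε ≤ ((f w).1 x - ⨅ x, (f w).1 x) ^ r := fun v hv w hw hvw x hx => by
    have h0 : ∀ u, 0 ≤ coneFun X L (c u) x := fun u => by unfold coneFun; positivity
    change (coneFun X L (c v) x - ⨅ x, coneFun X L (c v) x) ^ r < ε at hx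
    change ε ≤ (coneFun X L (c w) x - ⨅ x, coneFun X L (c w) x) ^ r
    rw [iInf_coneFun L (hcX _), sub_zero, ← hηr] at *
    exact Real.rpow_le_rpow hη.le
      (le_coneFun_of_lt (hsep v hv w hw hvw) ((Real.rpow_lt_rpow_iff (h0 v) hη.le hr0).1 hx)) hr0.le
  have hgrad : ∀ v w x, ‖g.grad (f v) x - g.grad (f w) x‖ ≤ 2 * L := fun v w x =>
    g.norm_grad_sub_le _ _ (hLip v) (hLip w) x
  have hlogV : (n : ℝ) / 8 * Real.log 2 ≤ Real.log V.card := by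
    rw [← Real.log_rpow (by norm_num)]
    exact Real.log_le_log (by positivity) hV
  -- Arithmetic shared by both oracles: K is ns² + 1 for FOG and 1 for SOG. The constant 128 is 8
  -- (code rate) times 16 (from `D`), and the -8 comes from Fano's log 2.
  have hbound : ∀ (K D T : ℝ), 0 < K → D = 16 * η ^ 2 * K / (n * s ^ 2 * σ ^ 2) →
      (1 - δ) * Real.log V.card ≤ T * D + Real.log 2 →
      ((1 - δ) * n - 8) * n * s ^ 2 * Real.log 2 / (128 * K) * ((σ : ℝ) ^ 2 / ε ^ (2 / r)) ≤ T := by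
    rintro K D T hK rfl h
    have h1 : (1 - δ) * ((n : ℝ) / 8 * Real.log 2) ≤ (1 - δ) * Real.log V.card :=
      mul_le_mul_of_nonneg_left hlogV (by linarith)
    rw [hη2, div_mul_div_comm, div_le_iff₀ (by positivity)]
    rw [mul_div_assoc', ← sub_le_iff_le_add, le_div_iff₀ (by positivity)] at h
    have h2 := mul_le_mul_of_nonneg_right h1 (by positivity : 0 ≤ (n : ℝ) * s ^ 2 * σ ^ 2)
    nlinarith
  constructor
  -- The factor 2√n·s is the diameter of the cube, which bounds the distance between apexes.
  · refine le_complexity _ fun T A hA => hbound (n * s ^ 2 + 1)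
      (((L * (2 * (√n * s))) ^ 2 + (2 * L) ^ 2) / (2 * σ ^ 2)) T (by positivity) ?_
      (A.log_card_le V hVne f hδ.le hA hmeas hsep' fun v w x =>
        entropyBound_lipFOG hX hX' g hσ (f v) (f w) x ?_ (hgrad v w x))
    · rw [mul_pow, mul_pow, mul_pow, mul_pow, Real.sq_sqrt hn0.le]
      have : (L : ℝ) ^ 2 = 8 * η ^ 2 / (n * s ^ 2) := by rw [eq_div_iff (by positivity), hL]
      rw [this]
      field_simp
      ring
    · refine (abs_coneFun_sub_le X L (c v) (c w) x).trans ?_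
      gcongr
      refine le_of_sq_le_sq ((hdist v w).trans_eq ?_) (by positivity)
      rw [mul_pow, mul_pow, Real.sq_sqrt hn0.le]
      ring
  · refine le_complexity _ fun T A hA => ?_
    have := hbound 1 ((2 * L) ^ 2 / (2 * σ ^ 2)) T one_pos ?_
      (A.log_card_le V hVne f hδ.le hA hmeas hsep' fun v w x =>
        entropyBound_lipSOG hX hX' g hσ (f v) (f w) x (hgrad v w x))
    · simpa only [mul_one] using this
    · have : (L : ℝ) ^ 2 = 8 * η ^ 2 / (n * s ^ 2) := by rw [eq_div_iff (by positivity), hL]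
      rw [mul_pow, this]
      field_simp
      ring
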